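/- Let $t_1,t_2,\dots$ and $t'_1,t'_2,\dots$ be formal parameters. Let $\Lambda$ be the infinite wedge space, the complex vector space with orthonormal basis $v_S=\underline{s_1}\wedge\underline{s_2}\wedge\cdots$, where $S=\{s_1>s_2>\cdots\}\subset\mathbb{Z}+\frac12$ is such that $S\setminus\{-\frac12,-\frac32,\dots\}$ and $\{-\frac12,-\frac32,\dots\}\setminus S$ are finite. Let $\psi_k f=\underline{k}\wedge f$, let $\psi^*_k$ be the adjoint of $\psi_k$ ($k\in\mathbb{Z}+\frac12$), let $v_\emptyset=\underline{-\frac12}\wedge\underline{-\frac32}\wedge\cdots$, and put $$\alpha_n=\sum_{k\in\mathbb{Z}+\frac12}\psi_{k-n}\psi^*_k\quad(n\neq0),\qquad \Gamma_{\pm}(s)=\exp\Big(\sum_{n\ge1}s_n\alpha_{\pm n}\Big),\qquad G=\Gamma_+(t)\,\Gamma_-(t')^{-1},$$ where the exponentials are formal power series in the parameters whose coefficients are linear operators on $\Lambda$. Let $\Psi_k=G\psi_kG^{-1}$, $\Psi^*_k=G\psi^*_kG^{-1}$ and $$K(i,j)=\big(\Psi_i\Psi^*_j\,v_\emptyset,v_\emptyset\big)\in\mathbb{C}[[t,t']],\qquad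 i,j\in\mathbb{Z}+\tfrac12 .$$ For $z\in\mathbb{C}\setminus\{0\}$ put $$J(z)=\exp\Big(\sum_{k\ge1}t_kz^k-\sum_{k\ge1}t'_kz^{-k}\Big)\in\mathbb{C}[[t,t']].$$ **Theorem.** Let $z,w\in\mathbb{C}$ with $0<|w|<|z|$, and fix square roots $\sqrt z$, $\sqrt w$; put $z^{i}=(\sqrt z)^{2i}$, $w^{-j}=(\sqrt w)^{-2j}$ for $i,j\in\mathbb{Z}+\frac12$, and $\sqrt{zw}=\sqrt z\sqrt w$. Then $$\sum_{i,j\in\mathbb{Z}+\frac12}z^iw^{-j}K(i,j)=\frac{\sqrt{zw}}{z-w}\,\frac{J(z)}{J(w)},$$ where the family on the left is (unconditionally) summable in $\mathbb{C}[[t,t']]$ coefficient by coefficient. The same identity holds in $\mathbb{C}[[x,y]]$, $x=(x_1,x_2,\dots)$, $y=(y_1,y_2,\dots)$, after the substitution $t_k=\frac1k\sum_ix_i^k$, $t'_k=\frac1k\sum_iy_i^k$, and under this substitution, for every $z\neq0$, $$J(z)=\prod_i\frac{1-y_i/z}{1-x_iz}.$$ -/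

import Mathlib

open scoped MvPowerSeries.WithPiTopology

noncomputable section

namespace SchurMeasure

/-! ### The infinite wedge space

Throughout, an integer `n` encodes the half-integer `n + 1/2`. Thus `n < 0` encodes the negative
half-integers `-1/2, -3/2, …`, and differences of half-integers are differences of codes. -/

/-- The subsets `S` of `ℤ + 1/2` that index the basis of the infinite wedge space:
`S₊ = S \ {-1/2, -3/2, …}` and `S₋ = {-1/2, -3/2, …} \ S` are finite. -/
structure Maya where
  /-- The underlying set. -/
  carrier : Set ℤ
  /-- `S₊` is finite. -/
  finite_pos : (carrier \ {n : ℤ | n < 0}).Finite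
  /-- `S₋` is finite. -/
  finite_neg : ({n : ℤ | n < 0} \ carrier).Finite

/-- The vacuum configuration `{-1/2, -3/2, -5/2, …}`. -/
def Maya.vacuum : Maya where
  carrier := {n : ℤ | n < 0}
  finite_pos := by simp
  finite_neg := by simp

/-- `S ∪ {k}`. -/
def Maya.insert (S : Maya) (k : ℤ) : Maya where
  carrier := S.carrier ∪ {k}
  finite_pos := (S.finite_pos.union (Set.finite_singleton k)).subset (by
    rintro x ⟨hx | hx, hx'⟩
    · exact Or.inl ⟨hx, hx'⟩
    · exact Or.inr hx)
  finite_neg := S.finite_neg.subset (by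
    rintro x ⟨hx, hx'⟩
    exact ⟨hx, fun h => hx' (Or.inl h)⟩)

/-- `S \ {k}`. -/
def Maya.erase (S : Maya) (k : ℤ) : Maya where
  carrier := S.carrier \ {k}
  finite_pos := S.finite_pos.subset (by
    rintro x ⟨hx, hx'⟩
    exact ⟨hx.1, hx'⟩)
  finite_neg := (S.finite_neg.union (Set.finite_singleton k)).subset (by
    rintro x ⟨hx, hx'⟩
    by_cases h : x = k
    · exact Or.inr h
    · exact Or.inl ⟨hx, fun h' => hx' ⟨h', h⟩⟩)

/-- The infinite wedge space: the complex vector space with basis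
`v_S = s₁ ∧ s₂ ∧ s₃ ∧ ⋯`, `S = {s₁ > s₂ > ⋯}`. The coordinate `f S` is the inner product
`(f, v_S)` for the inner product in which the basis `v_S` is orthonormal. -/
abbrev Wedge : Type := Maya →₀ ℂ

/-- The basis vector `v_S`. -/
def basisVec (S : Maya) : Wedge := Finsupp.single S 1

/-- The sign `(-1) ^ #{s ∈ S : s > k}` that brings `k` to its place in a decreasing wedge. -/
def wedgeSign (S : Maya) (k : ℤ) : ℂ := (-1) ^ {s : ℤ | s ∈ S.carrier ∧ k < s}.ncard

open Classical in
/-- The fermion `ψ_k`, the exterior multiplication `f ↦ k ∧ f`. -/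
def psi (k : ℤ) : Module.End ℂ Wedge :=
  Finsupp.linearCombination ℂ fun S : Maya =>
    if k ∈ S.carrier then 0 else wedgeSign S k • basisVec (S.insert k)

open Classical in
/-- The fermion `ψ*_k`, the adjoint of `ψ_k` (see `psi_adjoint`). -/
def psiStar (k : ℤ) : Module.End ℂ Wedge :=
  Finsupp.linearCombination ℂ fun S : Maya =>
    if k ∈ S.carrier then wedgeSign S k • basisVec (S.erase k) else 0

theorem Maya.ext' {S T : Maya} (h : S.carrier = T.carrier) : S = T := by
  cases S; cases T; simp_all

/-- `(ψ_k v_S, v_T) = (v_S, ψ*_k v_T)`; all matrix entries are real. -/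
theorem psi_adjoint (k : ℤ) (S T : Maya) :
    psi k (basisVec S) T = psiStar k (basisVec T) S := by
  classical
  have hsign : ∀ S T : Maya, S.insert k = T → wedgeSign S k = wedgeSign T k := by
    rintro S _ rfl
    unfold wedgeSign
    congr 2
    ext s
    simp only [Maya.insert, Set.mem_ofPred_eq, Set.mem_union, Set.mem_singleton_iff]
    constructor
    · rintro ⟨h, h'⟩
      exact ⟨Or.inl h, h'⟩
    · rintro ⟨h | h, h'⟩
      · exact ⟨h, h'⟩
      · omega
  have hiff : (k ∉ S.carrier ∧ S.insert k = T) ↔ (k ∈ T.carrier ∧ T.erase k = S) := by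
    constructor
    · rintro ⟨h, rfl⟩
      refine ⟨Or.inr rfl, Maya.ext' ?_⟩
      ext s
      simp only [Maya.insert, Maya.erase, Set.mem_sdiff, Set.mem_union, Set.mem_singleton_iff]
      constructor
      · tauto
      · intro hs
        exact ⟨Or.inl hs, fun e => h (e ▸ hs)⟩
    · rintro ⟨h, rfl⟩
      refine ⟨fun h' => h'.2 rfl, Maya.ext' ?_⟩
      ext s
      simp only [Maya.insert, Maya.erase, Set.mem_sdiff, Set.mem_union, Set.mem_singleton_iff]
      constructor
      · rintro (hs | rfl)
        · exact hs.1
        · exact h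
      · intro hs
        by_cases e : s = k
        · exact Or.inr e
        · exact Or.inl ⟨hs, e⟩
  have h1 : psi k (basisVec S) T =
      if k ∉ S.carrier ∧ S.insert k = T then wedgeSign S k else 0 := by
    simp only [psi, basisVec, Finsupp.linearCombination_single, one_smul]
    by_cases h : k ∈ S.carrier <;> simp [h, Finsupp.single_apply]
  have h2 : psiStar k (basisVec T) S =
      if k ∈ T.carrier ∧ T.erase k = S then wedgeSign T k else 0 := by
    simp only [psiStar, basisVec, Finsupp.linearCombination_single, one_smul]
    by_cases h : k ∈ T.carrier <;> simp [h, Finsupp.single_apply]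
  rw [h1, h2]
  by_cases h : k ∉ S.carrier ∧ S.insert k = T
  · rw [if_pos h, if_pos (hiff.1 h), hsign S T h.2]
  · rw [if_neg h, if_neg (fun h' => h (hiff.2 h'))]

/-- The bosonic operators `α_n = ∑_k ψ_{k-n} ψ*_k`, for `n ≠ 0`. On every basis vector the sum
has only finitely many nonzero terms (see `alpha_finite`). -/
def alpha (n : ℤ) : Module.End ℂ Wedge :=
  Finsupp.linearCombination ℂ fun S : Maya =>
    ∑ᶠ k : ℤ, psi (k - n) (psiStar k (basisVec S))

theorem alpha_finite (n : ℤ) (hn : n ≠ 0) (S : Maya) :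
    (Function.support fun k : ℤ => psi (k - n) (psiStar k (basisVec S))).Finite := by
  classical
  have hsub : (Function.support fun k : ℤ => psi (k - n) (psiStar k (basisVec S))) ⊆
      {k | k ∈ S.carrier ∧ k - n ∉ S.carrier} := by
    intro k hk
    rw [Function.mem_support] at hk
    by_cases h : k ∈ S.carrier
    · refine ⟨h, fun h' => hk ?_⟩
      have : k - n ∈ (S.erase k).carrier := ⟨h', by simp [hn]⟩
      simp [psiStar, psi, basisVec, Finsupp.linearCombination_single, h, this]
    · exact absurd (by simp [psiStar, basisVec, Finsupp.linearCombination_single, h]) hk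
  have hfin : ((S.carrier \ {m : ℤ | m < 0}) ∪
      ((fun m : ℤ => m + n) '' ({m : ℤ | m < 0} \ S.carrier) ∪ Set.Icc (-|n|) |n|)).Finite :=
    S.finite_pos.union ((S.finite_neg.image _).union (Set.finite_Icc _ _))
  refine hfin.subset (hsub.trans ?_)
  rintro k ⟨hk, hk'⟩
  by_cases h0 : k < 0
  · by_cases h1 : k - n < 0
    · exact Or.inr (Or.inl ⟨k - n, ⟨h1, hk'⟩, by simp⟩)
    · refine Or.inr (Or.inr ⟨?_, ?_⟩)
      · have := neg_abs_le n
        omega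
      · have := abs_nonneg n
        omega
  · exact Or.inl ⟨hk, h0⟩

/-! ### Formal power series in the parameters -/

/-- The parameters: `Sum.inl k` stands for `t_k` and `Sum.inr k` for `t'_k`, `k = 1, 2, …`. -/
abbrev Param : Type := ℕ+ ⊕ ℕ+

/-- The linear form `∑_s a_s s` in the variables `s : σ`, with coefficients in a (not necessarily
commutative) ring, as a formal power series: the coefficient of the monomial `s` is `a_s`, and
that of every monomial which is not a single variable is `0`. -/
def linearForm {σ A : Type*} [Ring A] (a : σ → A) : MvPowerSeries σ A :=
  open Classical in
  fun d => ∑ s ∈ d.support, if d = Finsupp.single s 1 then a s else 0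

/-- The exponential `∑_m X ^ m / m!` of a formal power series `X` with zero constant term. Its
coefficient at a monomial `d` is a finite sum, as `X ^ m` starts in degree `m`
(see `coeff_pow_eq_zero`). -/
def formalExp {σ A : Type*} [Ring A] [Algebra ℂ A] (X : MvPowerSeries σ A) :
    MvPowerSeries σ A :=
  fun d => ∑ m ∈ Finset.range (d.degree + 1),
    ((m.factorial : ℂ)⁻¹) • MvPowerSeries.coeff d (X ^ m)

theorem coeff_pow_eq_zero {σ A : Type*} [Ring A] (X : MvPowerSeries σ A)
    (hX : MvPowerSeries.constantCoeff X = 0) (d : σ →₀ ℕ) (m : ℕ) (hm : d.degree < m) :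
    MvPowerSeries.coeff d (X ^ m) = 0 := by
  apply MvPowerSeries.coeff_of_lt_order
  refine lt_of_lt_of_le ?_ (MvPowerSeries.le_order_pow_of_constantCoeff_eq_zero m hX)
  exact_mod_cast hm

theorem constantCoeff_linearForm {σ A : Type*} [Ring A] (a : σ → A) :
    MvPowerSeries.constantCoeff (linearForm a) = 0 := by
  rw [← MvPowerSeries.coeff_zero_eq_constantCoeff_apply, MvPowerSeries.coeff_apply]
  simp [linearForm]

theorem constantCoeff_formalExp {σ A : Type*} [Ring A] [Algebra ℂ A] (X : MvPowerSeries σ A) :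
    MvPowerSeries.constantCoeff (formalExp X) = 1 := by
  rw [← MvPowerSeries.coeff_zero_eq_constantCoeff_apply, MvPowerSeries.coeff_apply]
  simp [formalExp]

theorem isUnit_formalExp {σ A : Type*} [Ring A] [Algebra ℂ A] (X : MvPowerSeries σ A) :
    IsUnit (formalExp X) := by
  rw [MvPowerSeries.isUnit_iff_constantCoeff, constantCoeff_formalExp]
  exact isUnit_one

/-! ### Vertex operators and the kernel -/

/-- Formal power series in `t`, `t'` whose coefficients are operators in the infinite wedge. -/
abbrev OpSeries : Type := MvPowerSeries Param (Module.End ℂ Wedge)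

/-- The vertex operator `Γ₊(t) = exp (∑_{n ≥ 1} t_n α_n)`. -/
def gammaPlus : OpSeries :=
  formalExp (linearForm (Sum.elim (fun n : ℕ+ => alpha (n : ℤ)) fun _ => 0))

/-- The vertex operator `Γ₋(t') = exp (∑_{n ≥ 1} t'_n α_{-n})`. -/
def gammaMinus : OpSeries :=
  formalExp (linearForm (Sum.elim (fun _ => 0) fun n : ℕ+ => alpha (-(n : ℤ))))

/-- `G = Γ₊(t) Γ₋(t')⁻¹`. The inverses here and below exist (see `isUnit_gammaMinus`,
`isUnit_G`). -/
def G : OpSeries := gammaPlus * Ring.inverse gammaMinus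

theorem isUnit_gammaPlus : IsUnit gammaPlus := isUnit_formalExp _

theorem isUnit_gammaMinus : IsUnit gammaMinus := isUnit_formalExp _

theorem isUnit_G : IsUnit G :=
  isUnit_gammaPlus.mul isUnit_gammaMinus.ringInverse

/-- `Ψ_k = G ψ_k G⁻¹`. -/
def Psi (k : ℤ) : OpSeries := G * MvPowerSeries.C (psi k) * Ring.inverse G

/-- `Ψ*_k = G ψ*_k G⁻¹`. -/
def PsiStar (k : ℤ) : OpSeries := G * MvPowerSeries.C (psiStar k) * Ring.inverse G

/-- The kernel `K(x, y) = (Ψ_x Ψ*_y v_∅, v_∅)`, a formal power series in `t`, `t'`, at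
`x = i + 1/2` and `y = j + 1/2`. -/
def K (i j : ℤ) : MvPowerSeries Param ℂ :=
  fun d => MvPowerSeries.coeff d (Psi i * PsiStar j) (basisVec Maya.vacuum) Maya.vacuum

/-- `J(z) = exp (∑_{k ≥ 1} t_k z ^ k - ∑_{k ≥ 1} t'_k z ^ (-k))`. -/
def J (z : ℂ) : MvPowerSeries Param ℂ :=
  formalExp (linearForm (Sum.elim (fun k : ℕ+ => z ^ (k : ℕ)) fun k : ℕ+ => -(z⁻¹) ^ (k : ℕ)))

/-! ### The variables `x_i`, `y_i` -/

/-- The formal variables `x_i = X (Sum.inl i)` and `y_i = X (Sum.inr i)`. -/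
abbrev Var : Type := ℕ ⊕ ℕ

/-- The power-sum parameters `t_k = (1/k) ∑_i x_i ^ k`, `t'_k = (1/k) ∑_i y_i ^ k`. -/
def miwa : Param → MvPowerSeries Var ℂ :=
  Sum.elim
    (fun k : ℕ+ => ((k : ℕ) : ℂ)⁻¹ • ∑' i : ℕ, (MvPowerSeries.X (Sum.inl i)) ^ (k : ℕ))
    (fun k : ℕ+ => ((k : ℕ) : ℂ)⁻¹ • ∑' i : ℕ, (MvPowerSeries.X (Sum.inr i)) ^ (k : ℕ))

/-- The formal power series in `x`, `y` obtained from one in `t`, `t'` by the substitution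
`miwa`. -/
def inVars (f : MvPowerSeries Param ℂ) : MvPowerSeries Var ℂ := MvPowerSeries.subst miwa f

end SchurMeasure

end

/-!
With `ψ(z) = ∑_k z ^ k ψ_k` and `ψ*(w) = ∑_k w ^ (-k) ψ*_k`, the anticommutation relations give
`[α_n, ψ(z)] = z ^ n ψ(z)` and `[α_n, ψ*(w)] = -w ^ n ψ*(w)` (`alpha_mul_psi`,
`alpha_mul_psiStar`). Hence conjugation by `G` multiplies `ψ(z)` by `J(z)` and `ψ*(w)` by `J(w)⁻¹`.
The two vertex operators never have to be interchanged, so the commutators of the `α_n` among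
themselves are not needed. What remains is the vacuum expectation of `ψ(z) ψ*(w)`, which is the
geometric series `∑_{k < 0} (z / w) ^ (k + 1/2) = √(z w) / (z - w)`.

The identities for generating functions in `z` and `w` are read coefficient by coefficient. To this
end `J` is lifted to a series `laurentJ` whose coefficients are Laurent polynomials in `z`, and
`psiMap i` extracts the coefficient of `z ^ i` from the product of a Laurent polynomial with `ψ(z)`.
The exponentials are handled by `formalExp_mul_mapCoeff`, which turns a commutation rule for an
exponent into one for the exponential, and of which `formalExp_add` is a special case. Finally, a
monomial in `t`, `t'` has as its coefficient a finite sum of pairings of Laurent polynomials, and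
for these the double series converges absolutely (`hasSum_vacuumPairing`).

The substitution of power sums is continuous (`continuous_subst`) and so carries over the first
identity. It turns the exponent of `J` into a sum of logarithms (`hasProd_inVars_J`), whose
exponentials are computed with the Euler operator (`one_sub_mul_formalExp_negLog`).
-/

noncomputable section

namespace SchurMeasure

open MvPowerSeries
open _root_.Finset hiding mem_antidiagonal antidiagonal
open _root_.Finset.HasAntidiagonal (mem_antidiagonal antidiagonal)

/-! ### The formal exponential -/

section FormalExp

variable {σ A B : Type*} [Ring A] [Algebra ℂ A] [Ring B] [Algebra ℂ B]

theorem hasSum_formalExp [TopologicalSpace A] {X : MvPowerSeries σ A}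
    (hX : constantCoeff X = 0) :
    HasSum (fun m : ℕ => ((m.factorial : ℂ)⁻¹) • X ^ m) (formalExp X) := by
  rw [WithPiTopology.hasSum_iff_hasSum_coeff]
  intro d
  have h : coeff d (formalExp X) =
      ∑ m ∈ range (d.degree + 1), coeff d (((m.factorial : ℂ)⁻¹) • X ^ m) := rfl
  rw [h]
  refine hasSum_sum_of_ne_finset_zero fun m hm => ?_
  have := coeff_pow_eq_zero X hX d m (by rw [mem_range] at hm; omega)
  change ((m.factorial : ℂ)⁻¹) • coeff d (X ^ m) = 0
  rw [this, smul_zero]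

/-- A linear map applied to every coefficient of a formal power series. -/
def mapCoeff (φ : B →ₗ[ℂ] A) : MvPowerSeries σ B →ₗ[ℂ] MvPowerSeries σ A where
  toFun f := fun d => φ (coeff d f)
  map_add' f g := by ext d; exact map_add φ _ _
  map_smul' c f := by ext d; exact map_smul φ c _

@[simp]
theorem coeff_mapCoeff (φ : B →ₗ[ℂ] A) (f : MvPowerSeries σ B) (d : σ →₀ ℕ) :
    coeff d (mapCoeff φ f) = φ (coeff d f) := rfl

/-- The binomial theorem for left multiplication by `X`, which is the sum of the commuting operations
`f ↦ P * f` and right multiplication by `Y`. -/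
theorem pow_mul_mapCoeff (φ : B →ₗ[ℂ] A) {X Y : MvPowerSeries σ A} {P : MvPowerSeries σ B}
    (h : ∀ f, X * mapCoeff φ f = mapCoeff φ (P * f) + mapCoeff φ f * Y)
    (f : MvPowerSeries σ B) (m : ℕ) :
    X ^ m * mapCoeff φ f =
      ∑ p ∈ antidiagonal m, m.choose p.1 • (mapCoeff φ (P ^ p.1 * f) * Y ^ p.2) := by
  induction m with
  | zero => simp
  | succ m ih =>
    rw [sum_antidiagonal_choose_succ_nsmul (fun a b => mapCoeff φ (P ^ a * f) * Y ^ b) m,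
      pow_succ', mul_assoc, ih, mul_sum, ← sum_add_distrib]
    refine sum_congr rfl fun p hp => ?_
    rw [mem_antidiagonal] at hp
    have hc : m.choose p.2 = m.choose p.1 := by
      rw [← hp, Nat.choose_symm_add]
    rw [hc, mul_smul_comm, ← mul_assoc, h, add_mul, ← mul_assoc P, ← pow_succ', mul_assoc _ Y,
      ← pow_succ', smul_add, add_comm]

/-- If multiplication by `X` on the left acts on the series `φ f` as multiplication of `f` by `P`
plus multiplication by `Y` on the right, then the exponentials are related multiplicatively.
Left and right multiplications commute, so this is the exponential of a sum of two commuting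
operators. -/
theorem formalExp_mul_mapCoeff (φ : B →ₗ[ℂ] A) {X Y : MvPowerSeries σ A} {P : MvPowerSeries σ B}
    (hX : constantCoeff X = 0) (hY : constantCoeff Y = 0) (hP : constantCoeff P = 0)
    (h : ∀ f, X * mapCoeff φ f = mapCoeff φ (P * f) + mapCoeff φ f * Y)
    (f : MvPowerSeries σ B) :
    formalExp X * mapCoeff φ f = mapCoeff φ (formalExp P * f) * formalExp Y := by
  -- All sums are finite in each coefficient, so they may be handled in the discrete topology.
  let : TopologicalSpace A := ⊥
  have : DiscreteTopology A := ⟨rfl⟩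
  let : TopologicalSpace B := ⊥
  have : DiscreteTopology B := ⟨rfl⟩
  have hcont : Continuous (mapCoeff φ : MvPowerSeries σ B →ₗ[ℂ] MvPowerSeries σ A) :=
    continuous_pi fun d => (continuous_of_discreteTopology (f := φ)).comp
      (WithPiTopology.continuous_coeff B d)
  have h1 := (hasSum_formalExp hX).mul_right (mapCoeff φ f)
  have h2 : HasSum (fun m : ℕ => mapCoeff φ (((m.factorial : ℂ)⁻¹ • P ^ m) * f))
      (mapCoeff φ (formalExp P * f)) :=
    ((hasSum_formalExp hP).mul_right f).map (mapCoeff φ) hcont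
  have h3 := hasSum_formalExp hY
  have h4 : Summable fun p : ℕ × ℕ =>
      mapCoeff φ (((p.1.factorial : ℂ)⁻¹ • P ^ p.1) * f) * ((p.2.factorial : ℂ)⁻¹ • Y ^ p.2) := by
    rw [WithPiTopology.summable_iff_summable_coeff]
    intro d
    refine summable_of_ne_finset_zero (s := range (d.degree + 1) ×ˢ range (d.degree + 1)) ?_
    rintro ⟨a, b⟩ hab
    classical
    rw [coeff_mul]
    refine sum_eq_zero fun e he => ?_
    rw [mem_antidiagonal] at he
    have hdeg : e.1.degree + e.2.degree = d.degree := by rw [← he, map_add]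
    rw [coeff_mapCoeff, coeff_mul]
    by_cases hb : d.degree < b
    · have : coeff e.2 ((b.factorial : ℂ)⁻¹ • Y ^ b) = 0 := by
        change ((b.factorial : ℂ)⁻¹) • coeff e.2 (Y ^ b) = 0
        rw [coeff_pow_eq_zero Y hY _ _ (by omega), smul_zero]
      rw [this, mul_zero]
    · have ha : d.degree < a := by
        simp only [mem_product, mem_range] at hab
        omega
      rw [sum_eq_zero, map_zero, zero_mul]
      intro e' he'
      rw [mem_antidiagonal] at he'
      have hdeg' : e'.1.degree + e'.2.degree = e.1.degree := by rw [← he', map_add]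
      have : coeff e'.1 ((a.factorial : ℂ)⁻¹ • P ^ a) = 0 := by
        change ((a.factorial : ℂ)⁻¹) • coeff e'.1 (P ^ a) = 0
        rw [coeff_pow_eq_zero P hP _ _ (by omega), smul_zero]
      rw [this, zero_mul]
  rw [← h1.tsum_eq, ← h2.tsum_eq, ← h3.tsum_eq,
    h2.summable.tsum_mul_tsum_eq_tsum_sum_antidiagonal h3.summable h4]
  congr 1
  ext1 m
  rw [smul_mul_assoc, pow_mul_mapCoeff φ h, smul_sum]
  refine sum_congr rfl fun p hp => ?_
  rw [mem_antidiagonal] at hp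
  rw [smul_mul_assoc, map_smul, smul_mul_smul_comm, ← Nat.cast_smul_eq_nsmul ℂ, smul_smul]
  congr 1
  have h5 := Nat.add_choose_mul_factorial_mul_factorial p.1 p.2
  rw [← Nat.choose_symm_add, hp] at h5
  have h6 : (m.factorial : ℂ) = m.choose p.1 * p.1.factorial * p.2.factorial := by
    exact_mod_cast h5.symm
  have := Nat.factorial_ne_zero p.1
  have := Nat.factorial_ne_zero p.2
  have h7 : (m.choose p.1 : ℂ) ≠ 0 := by
    exact_mod_cast (Nat.choose_pos (by omega)).ne'
  rw [h6]
  field_simp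

theorem formalExp_zero : formalExp (0 : MvPowerSeries σ A) = 1 := by
  let : TopologicalSpace A := ⊥
  have : DiscreteTopology A := ⟨rfl⟩
  refine (hasSum_formalExp (X := (0 : MvPowerSeries σ A)) (map_zero _)).unique ?_
  convert hasSum_single (f := fun m : ℕ => ((m.factorial : ℂ)⁻¹) • (0 : MvPowerSeries σ A) ^ m) 0 ?_
  · simp
  · intro m hm
    simp [hm]

theorem map_formalExp (φ : A →ₐ[ℂ] B) (X : MvPowerSeries σ A) :
    MvPowerSeries.map (φ : A →+* B) (formalExp X) = formalExp (MvPowerSeries.map (φ : A →+* B) X) := by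
  ext d
  rw [coeff_map]
  change φ (∑ m ∈ range (d.degree + 1), _) = ∑ m ∈ range (d.degree + 1), _
  rw [map_sum]
  refine sum_congr rfl fun m _ => ?_
  rw [map_smul, ← map_pow, coeff_map]
  rfl

theorem coeff_linearForm {σ A : Type*} [Ring A] (a : σ → A) (d : σ →₀ ℕ) [DecidableEq (σ →₀ ℕ)] :
    coeff d (linearForm a) = ∑ s ∈ d.support, if d = Finsupp.single s 1 then a s else 0 := by
  rw [coeff_apply, linearForm]
  congr!

theorem map_linearForm (φ : A →ₐ[ℂ] B) (a : σ → A) :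
    MvPowerSeries.map (φ : A →+* B) (linearForm a) = linearForm fun s => φ (a s) := by
  classical
  ext d
  simp only [coeff_map, coeff_linearForm, RingHom.coe_coe, map_sum]
  exact sum_congr rfl fun s _ => by split_ifs <;> simp

theorem linearForm_add {σ A : Type*} [Ring A] (a b : σ → A) :
    linearForm (fun s => a s + b s) = linearForm a + linearForm b := by
  classical
  ext d
  simp only [map_add, coeff_linearForm, ← sum_add_distrib]
  exact sum_congr rfl fun s _ => by split_ifs <;> simp

theorem linearForm_neg {σ A : Type*} [Ring A] (a : σ → A) :
    linearForm (fun s => -a s) = -linearForm a := by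
  classical
  ext d
  simp only [map_neg, coeff_linearForm, ← sum_neg_distrib]
  exact sum_congr rfl fun s _ => by split_ifs <;> simp

/-- If commutation with `a s` acts on the image of `φ` as multiplication by `p s`, then
conjugation by the exponential of the linear form in the `a s` acts as multiplication by the
exponential of the linear form in the `p s`. -/
theorem formalExp_linearForm_mul_mapCoeff (φ : B →ₗ[ℂ] A) (a : σ → A) (p : σ → B)
    (h : ∀ s b, a s * φ b = φ (p s * b) + φ b * a s) (f : MvPowerSeries σ B) :
    formalExp (linearForm a) * mapCoeff φ f =
      mapCoeff φ (formalExp (linearForm p) * f) * formalExp (linearForm a) := by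
  refine formalExp_mul_mapCoeff φ (constantCoeff_linearForm _) (constantCoeff_linearForm _)
    (constantCoeff_linearForm _) (fun f => ?_) f
  classical
  ext d
  rw [map_add, coeff_mapCoeff, coeff_mul, coeff_mul, coeff_mul, map_sum]
  have hswap : ∑ e ∈ antidiagonal d, coeff e.1 (mapCoeff φ f) * coeff e.2 (linearForm a) =
      ∑ e ∈ antidiagonal d, coeff e.2 (mapCoeff φ f) * coeff e.1 (linearForm a) := by
    conv_lhs => rw [← Finset.HasAntidiagonal.map_swap_antidiagonal, sum_map]
    rfl
  rw [hswap, ← sum_add_distrib]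
  refine sum_congr rfl fun e _ => ?_
  simp only [ coeff_linearForm, coeff_mapCoeff, sum_mul, mul_sum,
    map_sum, ← sum_add_distrib]
  refine sum_congr rfl fun s _ => ?_
  split_ifs
  · exact h s _
  · simp

end FormalExp

section Commutative

variable {σ A : Type*} [CommRing A] [Algebra ℂ A]

theorem formalExp_add {X Y : MvPowerSeries σ A} (hX : constantCoeff X = 0)
    (hY : constantCoeff Y = 0) : formalExp (X + Y) = formalExp X * formalExp Y := by
  have hid : ∀ f : MvPowerSeries σ A, mapCoeff LinearMap.id f = f := fun f => rfl
  have := formalExp_mul_mapCoeff (LinearMap.id : A →ₗ[ℂ] A) (X := X + Y) (Y := Y) (P := X)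
    (by rw [map_add, hX, hY, add_zero]) hY hX (fun f => by simp only [hid]; ring) 1
  simpa only [hid, mul_one] using this

theorem formalExp_sum {ι : Type*} (s : Finset ι) {X : ι → MvPowerSeries σ A}
    (hX : ∀ i, constantCoeff (X i) = 0) : formalExp (∑ i ∈ s, X i) = ∏ i ∈ s, formalExp (X i) := by
  classical
  induction s using Finset.induction_on with
  | empty => simp [formalExp_zero]
  | insert i s hi ih =>
    rw [sum_insert hi, prod_insert hi, formalExp_add (hX i) (by simp [hX]), ih]

theorem formalExp_mul_formalExp_neg {X : MvPowerSeries σ A} (hX : constantCoeff X = 0) :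
    formalExp X * formalExp (-X) = 1 := by
  rw [← formalExp_add hX (by rw [map_neg, hX, neg_zero]), add_neg_cancel, formalExp_zero]

end Commutative

section Conjugation

variable {σ A B : Type*} [Ring A] [Algebra ℂ A] [CommRing B] [Algebra ℂ B]

theorem inverse_formalExp_linearForm_mul_mapCoeff (φ : B →ₗ[ℂ] A) (a : σ → A) (p : σ → B)
    (h : ∀ s b, a s * φ b = φ (p s * b) + φ b * a s) (f : MvPowerSeries σ B) :
    Ring.inverse (formalExp (linearForm a)) * mapCoeff φ f =
      mapCoeff φ (formalExp (-linearForm p) * f) * Ring.inverse (formalExp (linearForm a)) := by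
  have hu : IsUnit (formalExp (linearForm a)) := isUnit_formalExp _
  have h1 := formalExp_linearForm_mul_mapCoeff φ a p h (formalExp (-linearForm p) * f)
  rw [← mul_assoc (formalExp (linearForm p)),
    formalExp_mul_formalExp_neg (constantCoeff_linearForm p), one_mul] at h1
  have h2 := congrArg (fun F => Ring.inverse (formalExp (linearForm a)) * F *
    Ring.inverse (formalExp (linearForm a))) h1
  simp only [mul_assoc, Ring.mul_inverse_cancel _ hu, mul_one] at h2
  rw [← h2, ← mul_assoc, Ring.inverse_mul_cancel _ hu, one_mul]

theorem mapCoeff_one (φ : B →ₗ[ℂ] A) : mapCoeff (σ := σ) φ 1 = C (φ 1) := by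
  classical
  ext1 d
  rw [coeff_mapCoeff, coeff_one, coeff_C]
  split_ifs <;> simp

/-- If commutation with `a s` and `a' s` acts on the image of `φ` as multiplication by `p s` and
`p' s`, then conjugation by the quotient of the exponentials of the linear forms in the `a s` and in
the `a' s` takes `φ 1` to the exponential of the linear form in the `p s - p' s`. -/
theorem conj_formalExp_linearForm (φ : B →ₗ[ℂ] A) (a a' : σ → A) (p p' : σ → B)
    (h : ∀ s b, a s * φ b = φ (p s * b) + φ b * a s)
    (h' : ∀ s b, a' s * φ b = φ (p' s * b) + φ b * a' s) :
    (formalExp (linearForm a) * Ring.inverse (formalExp (linearForm a'))) * C (φ 1) *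
        Ring.inverse (formalExp (linearForm a) * Ring.inverse (formalExp (linearForm a'))) =
      mapCoeff φ (formalExp (linearForm fun s => p s - p' s)) := by
  have hu : IsUnit (formalExp (linearForm a) * Ring.inverse (formalExp (linearForm a'))) :=
    (isUnit_formalExp _).mul (isUnit_formalExp _).ringInverse
  have hlin : (linearForm fun s => p s - p' s) = linearForm p + -linearForm p' := by
    simp only [sub_eq_add_neg, linearForm_add, linearForm_neg]
  rw [hlin, formalExp_add (constantCoeff_linearForm p)
    (by rw [map_neg, constantCoeff_linearForm, neg_zero]), ← mapCoeff_one,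
    mul_assoc (formalExp (linearForm a)), inverse_formalExp_linearForm_mul_mapCoeff φ a' p' h',
    ← mul_assoc (formalExp (linearForm a)), formalExp_linearForm_mul_mapCoeff φ a p h, mul_one,
    mul_assoc (mapCoeff φ _), mul_assoc (mapCoeff φ _), Ring.mul_inverse_cancel _ hu, mul_one]

end Conjugation


end SchurMeasure

end

noncomputable section

namespace SchurMeasure

/-! ### Anticommutation relations and the action of the bosonic operators -/

theorem end_ext {f g : Module.End ℂ Wedge} (h : ∀ S, f (basisVec S) = g (basisVec S)) : f = g :=
  Finsupp.lhom_ext' fun S => LinearMap.ext_ring (h S)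

open Classical in
theorem psi_basisVec (k : ℤ) (S : Maya) :
    psi k (basisVec S) =
      if k ∈ S.carrier then 0 else wedgeSign S k • basisVec (S.insert k) := by
  simp only [psi, basisVec, Finsupp.linearCombination_single, one_smul]

open Classical in
theorem psiStar_basisVec (k : ℤ) (S : Maya) :
    psiStar k (basisVec S) =
      if k ∈ S.carrier then wedgeSign S k • basisVec (S.erase k) else 0 := by
  simp only [psiStar, basisVec, Finsupp.linearCombination_single, one_smul]

theorem Maya.mem_insert {S : Maya} {k l : ℤ} :
    l ∈ (S.insert k).carrier ↔ l ∈ S.carrier ∨ l = k := Iff.rfl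

theorem Maya.mem_erase {S : Maya} {k l : ℤ} :
    l ∈ (S.erase k).carrier ↔ l ∈ S.carrier ∧ l ≠ k := Iff.rfl

theorem Maya.finite_above (S : Maya) (k : ℤ) : {s : ℤ | s ∈ S.carrier ∧ k < s}.Finite := by
  refine (S.finite_pos.union (Set.finite_Ico k 0)).subset ?_
  rintro s ⟨hs, hks⟩
  by_cases h : s < 0
  · exact Or.inr ⟨hks.le, h⟩
  · exact Or.inl ⟨hs, h⟩

theorem wedgeSign_mul_self (S : Maya) (k : ℤ) : wedgeSign S k * wedgeSign S k = 1 := by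
  rw [wedgeSign, ← mul_pow]
  norm_num

theorem wedgeSign_insert {S : Maya} {l : ℤ} (hl : l ∉ S.carrier) (k : ℤ) :
    wedgeSign (S.insert l) k = if k < l then -wedgeSign S k else wedgeSign S k := by
  split_ifs with h
  · have : {s : ℤ | s ∈ (S.insert l).carrier ∧ k < s} =
        insert l {s : ℤ | s ∈ S.carrier ∧ k < s} := by
      ext s
      simp only [Maya.mem_insert, Set.mem_ofPred_eq, Set.mem_insert_iff]
      constructor
      · tauto
      · rintro (rfl | h') <;> tauto
    rw [wedgeSign, this, Set.ncard_insert_of_notMem (fun h' => hl h'.1) (S.finite_above k),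
      pow_succ, wedgeSign, mul_neg_one]
  · have : {s : ℤ | s ∈ (S.insert l).carrier ∧ k < s} = {s : ℤ | s ∈ S.carrier ∧ k < s} := by
      ext s
      simp only [Maya.mem_insert, Set.mem_ofPred_eq]
      constructor
      · rintro ⟨h' | rfl, h''⟩
        · exact ⟨h', h''⟩
        · exact absurd h'' h
      · tauto
    rw [wedgeSign, this, wedgeSign]

theorem Maya.insert_erase {S : Maya} {k : ℤ} (hk : k ∈ S.carrier) : (S.erase k).insert k = S := by
  apply Maya.ext'
  ext s
  have : s = k → s ∈ S.carrier := fun h => h ▸ hk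
  simp only [Maya.mem_insert, Maya.mem_erase]
  tauto

theorem wedgeSign_erase {S : Maya} {l : ℤ} (hl : l ∈ S.carrier) (k : ℤ) :
    wedgeSign (S.erase l) k = if k < l then -wedgeSign S k else wedgeSign S k := by
  have h := wedgeSign_insert (S := S.erase l) (l := l) (fun h => h.2 rfl) k
  rw [Maya.insert_erase hl] at h
  rw [h]
  split_ifs <;> simp

theorem psi_mul_psi (k l : ℤ) : psi k * psi l = -(psi l * psi k) := by
  classical
  refine end_ext fun S => ?_
  simp only [Module.End.mul_apply, LinearMap.neg_apply, psi_basisVec]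
  by_cases hkl : k = l
  · subst hkl
    by_cases hk : k ∈ S.carrier <;> simp [hk, psi_basisVec, Maya.mem_insert]
  by_cases hk : k ∈ S.carrier
  · by_cases hl : l ∈ S.carrier <;> simp [hk, hl, psi_basisVec, Maya.mem_insert]
  by_cases hl : l ∈ S.carrier
  · simp [hk, hl, psi_basisVec, Maya.mem_insert]
  have hins : (S.insert l).insert k = (S.insert k).insert l := by
    apply Maya.ext'
    exact Set.union_right_comm _ _ _
  simp only [hk, hl, if_false, map_smul, psi_basisVec, Maya.mem_insert, hkl, Ne.symm hkl, or_self,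
    hins, wedgeSign_insert hl, wedgeSign_insert hk, smul_smul, ← neg_smul]
  congr 1
  rcases lt_or_gt_of_ne hkl with h | h
  · rw [if_pos h, if_neg h.le.not_gt]; ring
  · rw [if_neg h.le.not_gt, if_pos h]; ring

theorem psiStar_mul_psiStar (k l : ℤ) : psiStar k * psiStar l = -(psiStar l * psiStar k) := by
  classical
  refine end_ext fun S => ?_
  simp only [Module.End.mul_apply, LinearMap.neg_apply, psiStar_basisVec]
  by_cases hkl : k = l
  · subst hkl
    by_cases hk : k ∈ S.carrier <;> simp [hk, psiStar_basisVec, Maya.mem_erase]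
  by_cases hk : k ∈ S.carrier
  · by_cases hl : l ∈ S.carrier
    · have hins : (S.erase l).erase k = (S.erase k).erase l := by
        apply Maya.ext'
        ext s
        simp only [Maya.mem_erase]
        tauto
      simp only [hk, hl, if_true, map_smul, psiStar_basisVec, Maya.mem_erase, hkl, Ne.symm hkl,
        hins, wedgeSign_erase hl, wedgeSign_erase hk, smul_smul, ← neg_smul, ne_eq,
        not_false_eq_true, and_self]
      congr 1
      rcases lt_or_gt_of_ne hkl with h | h
      · rw [if_pos h, if_neg h.le.not_gt]; ring
      · rw [if_neg h.le.not_gt, if_pos h]; ring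
    · simp [hk, hl, psiStar_basisVec, Maya.mem_erase]
  · by_cases hl : l ∈ S.carrier <;> simp [hk, hl, psiStar_basisVec, Maya.mem_erase]

/-- `ψ*_k ψ_l + ψ_l ψ*_k = δ_{kl}`. -/
theorem psiStar_mul_psi (k l : ℤ) :
    psiStar k * psi l = (if k = l then 1 else 0) - psi l * psiStar k := by
  classical
  refine end_ext fun S => ?_
  simp only [Module.End.mul_apply, LinearMap.sub_apply, psi_basisVec, psiStar_basisVec]
  by_cases hkl : k = l
  · subst hkl
    by_cases hk : k ∈ S.carrier
    · have : k ∉ (S.erase k).carrier := fun h => h.2 rfl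
      simp only [hk, if_true, map_zero, map_smul, psi_basisVec, this, if_false, Maya.insert_erase,
        wedgeSign_erase hk, lt_self_iff_false, smul_smul, wedgeSign_mul_self, one_smul,
        Module.End.one_apply, sub_self]
    · have h1 : k ∈ (S.insert k).carrier := Or.inr rfl
      have h2 : (S.insert k).erase k = S := by
        apply Maya.ext'
        ext s
        have : s = k → s ∉ S.carrier := fun h => h ▸ hk
        simp only [Maya.mem_insert, Maya.mem_erase]
        tauto
      simp only [hk, if_true, map_zero, map_smul, psiStar_basisVec, h1, if_false, h2,
        wedgeSign_insert hk, lt_self_iff_false, smul_smul, wedgeSign_mul_self, one_smul,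
        Module.End.one_apply, sub_zero]
  simp only [hkl, if_false, LinearMap.zero_apply, zero_sub]
  by_cases hl : l ∈ S.carrier
  · by_cases hk : k ∈ S.carrier <;>
      simp [hk, hl, psi_basisVec, Maya.mem_erase, Ne.symm hkl]
  by_cases hk : k ∈ S.carrier
  · have h : (S.insert l).erase k = (S.erase k).insert l := by
      apply Maya.ext'
      ext s
      have : s = l → s ≠ k := fun h h' => hkl (h'.symm.trans h)
      simp only [Maya.mem_insert, Maya.mem_erase]
      tauto
    simp only [hk, hl, if_true, if_false, map_smul, psi_basisVec, psiStar_basisVec,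
      Maya.mem_insert, Maya.mem_erase, true_or, false_and, h, wedgeSign_insert hl,
      wedgeSign_erase hk, smul_smul, ← neg_smul]
    congr 1
    rcases lt_or_gt_of_ne hkl with h | h
    · rw [if_pos h, if_neg h.le.not_gt]; ring
    · rw [if_neg h.le.not_gt, if_pos h]; ring
  · simp [hk, hl, psiStar_basisVec, Maya.mem_insert, hkl]

/-- The sum that defines `α_n` on basis vectors is finite, and gives `α_n`, on every vector. -/
theorem alpha_apply {n : ℤ} (hn : n ≠ 0) (x : Wedge) :
    (Function.support fun k : ℤ => psi (k - n) (psiStar k x)).Finite ∧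
      alpha n x = ∑ᶠ k : ℤ, psi (k - n) (psiStar k x) := by
  induction x using Finsupp.induction_linear with
  | zero => simp
  | add x y hx hy =>
    simp only [map_add, finsum_add_distrib hx.1 hy.1, hx.2, hy.2, and_true]
    exact (hx.1.union hy.1).subset (Function.support_add _ _)
  | single S c =>
    have hS : (Finsupp.single S c : Wedge) = c • basisVec S := by simp [basisVec]
    simp only [hS, map_smul]
    refine ⟨(alpha_finite n hn S).subset fun k hk h => hk (by simp only [h, smul_zero]), ?_⟩
    rw [← smul_finsum' c (alpha_finite n hn S)]
    simp [alpha, basisVec]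

/-- `[α_n, ψ_k] = ψ_{k-n}`. -/
theorem alpha_mul_psi {n : ℤ} (hn : n ≠ 0) (k : ℤ) :
    alpha n * psi k = psi (k - n) + psi k * alpha n := by
  classical
  refine LinearMap.ext fun x => ?_
  have hterm : ∀ l : ℤ, psi (l - n) (psiStar l (psi k x)) =
      (if l = k then psi (k - n) x else 0) + psi k (psi (l - n) (psiStar l x)) := by
    intro l
    have h1 := LinearMap.congr_fun (psiStar_mul_psi l k) x
    have h2 := LinearMap.congr_fun (psi_mul_psi (l - n) k) (psiStar l x)
    simp only [Module.End.mul_apply, LinearMap.sub_apply, LinearMap.neg_apply] at h1 h2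
    rw [h1, map_sub, h2, sub_neg_eq_add]
    congr 1
    split_ifs with h
    · rw [h]; rfl
    · simp
  have hfin := (alpha_apply hn x).1
  simp only [Module.End.mul_apply, LinearMap.add_apply]
  rw [(alpha_apply hn _).2, (alpha_apply hn _).2, map_finsum _ hfin, finsum_congr hterm,
    finsum_add_distrib, finsum_eq_single _ k (fun l hl => if_neg hl), if_pos rfl]
  · exact (Set.finite_singleton k).subset fun l hl => by
      by_contra h
      exact hl (if_neg h)
  · exact hfin.subset fun l hl h => hl (by simp only [h, map_zero])

/-- `[α_n, ψ*_k] = -ψ*_{k+n}`. -/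
theorem alpha_mul_psiStar {n : ℤ} (hn : n ≠ 0) (k : ℤ) :
    alpha n * psiStar k = -psiStar (k + n) + psiStar k * alpha n := by
  classical
  refine LinearMap.ext fun x => ?_
  have hterm : ∀ l : ℤ, psi (l - n) (psiStar l (psiStar k x)) =
      (if l = k + n then -psiStar (k + n) x else 0) + psiStar k (psi (l - n) (psiStar l x)) := by
    intro l
    have h1 := LinearMap.congr_fun (psiStar_mul_psiStar l k) x
    have h2 := LinearMap.congr_fun (psiStar_mul_psi k (l - n)) (psiStar l x)
    simp only [Module.End.mul_apply, LinearMap.sub_apply, LinearMap.neg_apply] at h1 h2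
    rw [h1, map_neg, h2]
    by_cases h : l = k + n
    · have h' : k = l - n := by omega
      rw [if_pos h, if_pos h', Module.End.one_apply, h]
      abel
    · have h' : k ≠ l - n := by omega
      rw [if_neg h, if_neg h', LinearMap.zero_apply]
      abel
  have hfin := (alpha_apply hn x).1
  simp only [Module.End.mul_apply, LinearMap.add_apply, LinearMap.neg_apply]
  rw [(alpha_apply hn _).2, (alpha_apply hn _).2, map_finsum _ hfin, finsum_congr hterm,
    finsum_add_distrib, finsum_eq_single _ (k + n) (fun l hl => if_neg hl), if_pos rfl]
  · exact (Set.finite_singleton (k + n)).subset fun l hl => by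
      by_contra h
      exact hl (if_neg h)
  · exact hfin.subset fun l hl h => hl (by simp only [h, map_zero])

theorem psi_psiStar_vacuum (k l : ℤ) :
    psi k (psiStar l (basisVec Maya.vacuum)) Maya.vacuum = if k = l ∧ k < 0 then 1 else 0 := by
  classical
  have hmem : l ∈ Maya.vacuum.carrier ↔ l < 0 := Iff.rfl
  by_cases hl : l < 0
  · rw [psiStar_basisVec, if_pos (hmem.2 hl), map_smul, psi_basisVec]
    by_cases hkl : k = l
    · subst hkl
      rw [if_neg (fun h => h.2 rfl), Maya.insert_erase (hmem.2 hl), smul_smul,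
        wedgeSign_erase (hmem.2 hl), if_neg (lt_irrefl k), wedgeSign_mul_self, if_pos ⟨rfl, hl⟩]
      simp [basisVec]
    · rw [if_neg (fun h : k = l ∧ k < 0 => hkl h.1)]
      split_ifs
      · simp
      · have : (Maya.vacuum.erase l).insert k ≠ Maya.vacuum := by
          intro h
          have h1 : l ∈ ((Maya.vacuum.erase l).insert k).carrier := by rw [h]; exact hl
          rcases h1 with h1 | h1
          · exact h1.2 rfl
          · exact hkl h1.symm
        simp [basisVec, this]
  · rw [psiStar_basisVec, if_neg (fun h => hl (hmem.1 h)), if_neg (by omega)]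
    simp

end SchurMeasure

end

noncomputable section

namespace SchurMeasure

open MvPowerSeries hiding C eval₂_C
open LaurentPolynomial hiding C
open _root_.Finset hiding mem_antidiagonal antidiagonal
open _root_.Finset.HasAntidiagonal (mem_antidiagonal antidiagonal)

/-! ### Conjugation by the vertex operators -/

/-- The linear map on Laurent polynomials that sends `T n` to `F n`. -/
def laurentMap {M : Type*} [AddCommGroup M] [Module ℂ M] (F : ℤ → M) : ℂ[T;T⁻¹] →ₗ[ℂ] M :=
  (AddMonoidAlgebra.basis ℤ ℂ).constr ℂ F

@[simp]
theorem laurentMap_T {M : Type*} [AddCommGroup M] [Module ℂ M] (F : ℤ → M) (n : ℤ) :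
    laurentMap F (T n) = F n := by
  have : (T n : ℂ[T;T⁻¹]) = AddMonoidAlgebra.basis ℤ ℂ n := rfl
  rw [this, laurentMap, Module.Basis.constr_basis]

theorem laurentMap_ext {M : Type*} [AddCommGroup M] [Module ℂ M] {φ φ' : ℂ[T;T⁻¹] →ₗ[ℂ] M}
    (h : ∀ n, φ (T n) = φ' (T n)) : φ = φ' :=
  (AddMonoidAlgebra.basis ℤ ℂ).ext h

/-- The coefficients of the linear form `∑_n t_n T ^ n - ∑_n t'_n T ^ (-n)`. -/
def expCoeff : Param → ℂ[T;T⁻¹] := Sum.elim (fun n : ℕ+ => T (n : ℤ)) fun n : ℕ+ => -T (-(n : ℤ))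

/-- The generating series `J` with coefficients in the Laurent polynomials in `T = z`. -/
def laurentJ : MvPowerSeries Param ℂ[T;T⁻¹] := formalExp (linearForm expCoeff)

/-- The inverse of `laurentJ`. -/
def laurentJInv : MvPowerSeries Param ℂ[T;T⁻¹] := formalExp (linearForm fun s => -expCoeff s)

theorem laurentJ_mul_laurentJInv : laurentJ * laurentJInv = 1 := by
  rw [laurentJ, laurentJInv, linearForm_neg,
    formalExp_mul_formalExp_neg (constantCoeff_linearForm _)]

/-- The linear map that sends `T n` to `ψ_{i-n}`: the Laurent polynomial `f` goes to the
coefficient of `z ^ i` in `f(z) ∑_k z ^ k ψ_k`. -/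
def psiMap (i : ℤ) : ℂ[T;T⁻¹] →ₗ[ℂ] Module.End ℂ Wedge := laurentMap fun n => psi (i - n)

/-- The linear map that sends `T n` to `ψ*_{j+n}`: the Laurent polynomial `f` goes to the
coefficient of `w ^ (-j)` in `f(w) ∑_k w ^ (-k) ψ*_k`. -/
def psiStarMap (j : ℤ) : ℂ[T;T⁻¹] →ₗ[ℂ] Module.End ℂ Wedge := laurentMap fun n => psiStar (j + n)

/-- `[α_n, ψ(z)] = z ^ n ψ(z)`, coefficient by coefficient. -/
theorem alpha_mul_psiMap {n : ℤ} (hn : n ≠ 0) (i : ℤ) (b : ℂ[T;T⁻¹]) :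
    alpha n * psiMap i b = psiMap i (T n * b) + psiMap i b * alpha n := by
  have : LinearMap.mulLeft ℂ (alpha n) ∘ₗ psiMap i =
      psiMap i ∘ₗ LinearMap.mulLeft ℂ (T n) + LinearMap.mulRight ℂ (alpha n) ∘ₗ psiMap i := by
    refine laurentMap_ext (M := Module.End ℂ Wedge) fun m => ?_
    simp only [LinearMap.comp_apply, LinearMap.add_apply, LinearMap.mulLeft_apply,
      LinearMap.mulRight_apply, psiMap, ← T_add, laurentMap_T, alpha_mul_psi hn]
    rw [sub_sub, add_comm m]
  exact LinearMap.congr_fun this b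

/-- `[α_n, ψ*(w)] = -w ^ n ψ*(w)`, coefficient by coefficient. -/
theorem alpha_mul_psiStarMap {n : ℤ} (hn : n ≠ 0) (j : ℤ) (b : ℂ[T;T⁻¹]) :
    alpha n * psiStarMap j b = psiStarMap j (-T n * b) + psiStarMap j b * alpha n := by
  have : LinearMap.mulLeft ℂ (alpha n) ∘ₗ psiStarMap j =
      psiStarMap j ∘ₗ LinearMap.mulLeft ℂ (-T n) +
        LinearMap.mulRight ℂ (alpha n) ∘ₗ psiStarMap j := by
    refine laurentMap_ext (M := Module.End ℂ Wedge) fun m => ?_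
    simp only [LinearMap.comp_apply, LinearMap.add_apply, LinearMap.mulLeft_apply,
      LinearMap.mulRight_apply, psiStarMap, neg_mul, map_neg, ← T_add, laurentMap_T,
      alpha_mul_psiStar hn]
    rw [add_assoc, add_comm m]
  exact LinearMap.congr_fun this b

/-- If commutation with `α_n` acts on the image of `φ` as multiplication by `p n`, then conjugation by
`G` takes `φ 1` to the exponential of `∑_n t_n p_n - ∑_n t'_n p_{-n}`. -/
theorem conj_G (φ : ℂ[T;T⁻¹] →ₗ[ℂ] Module.End ℂ Wedge) (p : ℤ → ℂ[T;T⁻¹])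
    (h : ∀ n : ℤ, n ≠ 0 → ∀ b, alpha n * φ b = φ (p n * b) + φ b * alpha n) :
    G * MvPowerSeries.C (φ 1) * Ring.inverse G =
      mapCoeff φ (formalExp (linearForm
        (Sum.elim (fun n : ℕ+ => p n) fun n : ℕ+ => -p (-(n : ℤ))))) := by
  have hplus : ∀ (s : Param) b,
      (Sum.elim (fun n : ℕ+ => alpha (n : ℤ)) (fun _ => 0) s : Module.End ℂ Wedge) * φ b =
        φ ((Sum.elim (fun n : ℕ+ => p n) (fun _ => 0) s : ℂ[T;T⁻¹]) * b) +
          φ b * (Sum.elim (fun n : ℕ+ => alpha (n : ℤ)) (fun _ => 0) s : Module.End ℂ Wedge) := by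
    rintro (n | n) b
    · exact h n (by simp) b
    · simp
  have hminus : ∀ (s : Param) b,
      (Sum.elim (fun _ => 0) (fun n : ℕ+ => alpha (-(n : ℤ))) s : Module.End ℂ Wedge) * φ b =
        φ ((Sum.elim (fun _ => 0) (fun n : ℕ+ => p (-(n : ℤ))) s : ℂ[T;T⁻¹]) * b) +
          φ b * (Sum.elim (fun _ => 0) (fun n : ℕ+ => alpha (-(n : ℤ))) s :
            Module.End ℂ Wedge) := by
    rintro (n | n) b
    · simp
    · exact h (-n) (by simp) b
  have hconj := conj_formalExp_linearForm (A := Module.End ℂ Wedge) (B := ℂ[T;T⁻¹]) φ _ _ _ _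
    hplus hminus
  have hlin : (fun s : Param => (Sum.elim (fun n : ℕ+ => p n) (fun _ => 0) s : ℂ[T;T⁻¹]) -
      (Sum.elim (fun _ => 0) (fun n : ℕ+ => p (-(n : ℤ))) s : ℂ[T;T⁻¹])) =
      Sum.elim (fun n : ℕ+ => p n) fun n : ℕ+ => -p (-(n : ℤ)) := by
    ext1 s
    rcases s with n | n <;> simp
  rw [hlin] at hconj
  rw [G, gammaPlus, gammaMinus]
  exact hconj

/-- `G ψ(z) G⁻¹ = J(z) ψ(z)`, coefficient by coefficient. -/
theorem Psi_eq (i : ℤ) : Psi i = mapCoeff (psiMap i) laurentJ := by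
  have h0 : psi i = psiMap i 1 := by rw [← T_zero, psiMap, laurentMap_T, sub_zero]
  rw [Psi, h0, conj_G (psiMap i) T fun n hn b => alpha_mul_psiMap hn i b]
  rfl

/-- `G ψ*(w) G⁻¹ = J(w)⁻¹ ψ*(w)`, coefficient by coefficient. -/
theorem PsiStar_eq (j : ℤ) : PsiStar j = mapCoeff (psiStarMap j) laurentJInv := by
  have h0 : psiStar j = psiStarMap j 1 := by rw [← T_zero, psiStarMap, laurentMap_T, add_zero]
  have hlin : (Sum.elim (fun n : ℕ+ => -T (n : ℤ)) fun n : ℕ+ => - -T (-(n : ℤ))) =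
      fun s => -expCoeff s := by
    ext1 s
    rcases s with n | n <;> rfl
  rw [PsiStar, h0, conj_G (psiStarMap j) (fun n => -T n) fun n hn b => alpha_mul_psiStarMap hn j b,
    hlin]
  rfl

/-! ### The generating function of the kernel -/

theorem hasSum_of_eq {ι M : Type*} [AddCommMonoid M] [TopologicalSpace M] {f g : ι → M} {a b : M}
    (h : HasSum f a) (hf : ∀ i, g i = f i) (ha : b = a) : HasSum g b := by
  rw [ha, funext hf]
  exact h

/-- The vacuum expectation of `psiMap i f * psiStarMap j g`. -/
def vacuumPairing (i j : ℤ) (f g : ℂ[T;T⁻¹]) : ℂ :=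
  (psiMap i f * psiStarMap j g) (basisVec Maya.vacuum) Maya.vacuum

theorem vacuumPairing_T (i j a b : ℤ) :
    vacuumPairing i j (T a) (T b) = if i - a = j + b ∧ i - a < 0 then 1 else 0 := by
  rw [vacuumPairing, psiMap, psiStarMap, laurentMap_T, laurentMap_T, Module.End.mul_apply,
    psi_psiStar_vacuum]

theorem coeff_K (i j : ℤ) (d : Param →₀ ℕ) :
    coeff d (K i j) =
      ∑ e ∈ antidiagonal d, vacuumPairing i j (coeff e.1 laurentJ) (coeff e.2 laurentJInv) := by
  classical
  change coeff d (Psi i * PsiStar j) (basisVec Maya.vacuum) Maya.vacuum = _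
  rw [Psi_eq, PsiStar_eq, coeff_mul, LinearMap.sum_apply, Finsupp.finsetSum_apply]
  rfl

/-- Evaluation of Laurent polynomials at a nonzero complex number. -/
def laurentEval (z : ℂ) (hz : z ≠ 0) : ℂ[T;T⁻¹] →ₐ[ℂ] ℂ where
  __ := LaurentPolynomial.eval₂ (RingHom.id ℂ) (Units.mk0 z hz)
  commutes' r := by
    change LaurentPolynomial.eval₂ (RingHom.id ℂ) (Units.mk0 z hz) (LaurentPolynomial.C r) = r
    rw [LaurentPolynomial.eval₂_C, RingHom.id_apply]

theorem laurentEval_T (z : ℂ) (hz : z ≠ 0) (n : ℤ) : laurentEval z hz (T n) = z ^ n := by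
  change LaurentPolynomial.eval₂ (RingHom.id ℂ) (Units.mk0 z hz) (T n) = z ^ n
  rw [eval₂_T, Units.val_zpow_eq_zpow_val, Units.val_mk0]

theorem map_laurentJ (z : ℂ) (hz : z ≠ 0) :
    MvPowerSeries.map (laurentEval z hz : ℂ[T;T⁻¹] →+* ℂ) laurentJ = J z := by
  rw [laurentJ, map_formalExp, map_linearForm, J]
  congr! 3 with s
  rcases s with n | n
  · simp [expCoeff, laurentEval_T]
  · simp [expCoeff, laurentEval_T]

theorem map_laurentJInv (z : ℂ) (hz : z ≠ 0) :
    MvPowerSeries.map (laurentEval z hz : ℂ[T;T⁻¹] →+* ℂ) laurentJInv = (J z)⁻¹ := by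
  have h1 : constantCoeff (J z) ≠ 0 := by
    rw [J, constantCoeff_formalExp]
    exact one_ne_zero
  rw [MvPowerSeries.eq_inv_iff_mul_eq_one h1, ← map_laurentJ z hz, ← map_mul, mul_comm,
    laurentJ_mul_laurentJInv, map_one]

/-- The expansion of the Cauchy kernel: after the shift by `a` and `b`, a geometric series in
`v ^ 2 / u ^ 2`. -/
theorem hasSum_vacuumPairing_T {u v : ℂ} (hv : v ≠ 0) (h : ‖v ^ 2‖ < ‖u ^ 2‖) (a b : ℤ) :
    HasSum (fun p : ℤ × ℤ => (u ^ (2 * p.1 + 1) * v ^ (-(2 * p.2 + 1))) *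
        vacuumPairing p.1 p.2 (T a) (T b))
      (u * v / (u ^ 2 - v ^ 2) * ((u ^ 2) ^ a * (v ^ 2) ^ b)) := by
  have hu : u ≠ 0 := by
    rintro rfl
    simp only [ne_eq, OfNat.ofNat_ne_zero, not_false_eq_true, zero_pow, norm_zero] at h
    exact absurd h (norm_nonneg _).not_gt
  -- The pairing is nonzero only at the points `(a + k, k - b)` with `k = -1 - n < 0`.
  have hinj : Function.Injective fun n : ℕ => ((a - 1 - n, -1 - n - b) : ℤ × ℤ) := by
    intro m n hmn
    have := congrArg Prod.fst hmn
    simp only at this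
    omega
  rw [← hinj.hasSum_iff]
  · have hlt : ‖v ^ 2 / u ^ 2‖ < 1 := by
      rw [norm_div]
      exact (div_lt_one ((norm_nonneg _).trans_lt h)).2 h
    have hne : u ^ 2 - v ^ 2 ≠ 0 := by
      intro h0
      rw [sub_eq_zero.1 h0] at h
      exact lt_irrefl _ h
    refine hasSum_of_eq ((hasSum_geometric_of_norm_lt_one hlt).mul_left
      ((v / u) * ((u ^ 2) ^ a * (v ^ 2) ^ b))) (fun n => ?_) ?_
    · simp only [Function.comp_apply, vacuumPairing_T]
      rw [if_pos (by omega), mul_one]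
      have e1 : 2 * (a - 1 - (n : ℤ)) + 1 = 2 * a - 1 - 2 * n := by ring
      have e2 : -(2 * (-1 - (n : ℤ) - b) + 1) = 2 * b + 1 + 2 * n := by ring
      rw [e1, e2, zpow_sub₀ hu, zpow_sub₀ hu, zpow_add₀ hv, zpow_add₀ hv, zpow_mul,
        zpow_mul v 2 b, zpow_mul v 2 n, zpow_one, zpow_one, div_pow]
      norm_cast
      rw [pow_mul u]
      field_simp
    · have : 1 - v ^ 2 / u ^ 2 = (u ^ 2 - v ^ 2) / u ^ 2 := by field_simp
      rw [this]
      field_simp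
  · rintro ⟨i, j⟩ hij
    rw [vacuumPairing_T, if_neg, mul_zero]
    rintro ⟨h1, h2⟩
    refine hij ⟨(a - 1 - i).toNat, ?_⟩
    simp only [Prod.mk.injEq]
    omega

theorem hasSum_vacuumPairing {u v : ℂ} (hu : u ^ 2 ≠ 0) (hv : v ^ 2 ≠ 0)
    (h : ‖v ^ 2‖ < ‖u ^ 2‖) (f g : ℂ[T;T⁻¹]) :
    HasSum (fun p : ℤ × ℤ => (u ^ (2 * p.1 + 1) * v ^ (-(2 * p.2 + 1))) *
        vacuumPairing p.1 p.2 f g)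
      (u * v / (u ^ 2 - v ^ 2) * (laurentEval _ hu f * laurentEval _ hv g)) := by
  have hC : ∀ (n : ℤ) (a : ℂ), (LaurentPolynomial.C a * T n : ℂ[T;T⁻¹]) = a • T n := fun n a => by
    rw [LaurentPolynomial.smul_eq_C_mul]
  induction f using LaurentPolynomial.induction_on' with
  | add f₁ f₂ h₁ h₂ =>
    refine hasSum_of_eq (h₁.add h₂) (fun p => ?_) ?_
    · simp only [vacuumPairing, map_add, add_mul, LinearMap.add_apply, Finsupp.add_apply, mul_add]
    · rw [map_add]; ring
  | C_mul_T n a =>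
    induction g using LaurentPolynomial.induction_on' with
    | add g₁ g₂ h₁ h₂ =>
      refine hasSum_of_eq (h₁.add h₂) (fun p => ?_) ?_
      · simp only [vacuumPairing, map_add, mul_add, LinearMap.add_apply, Finsupp.add_apply]
      · rw [map_add]; ring
    | C_mul_T m b =>
      refine hasSum_of_eq ((hasSum_vacuumPairing_T (fun h0 => hv (by rw [h0]; ring)) h n m).mul_left
        (a * b)) (fun p => ?_) ?_
      · simp only [hC, vacuumPairing, map_smul, smul_mul_smul_comm, LinearMap.smul_apply,
          Finsupp.smul_apply, smul_eq_mul]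
        ring
      · simp only [hC, map_smul, laurentEval_T, smul_eq_mul]
        ring

theorem hasSum_K {u v : ℂ} (hu : u ^ 2 ≠ 0) (hv : v ^ 2 ≠ 0) (h : ‖v ^ 2‖ < ‖u ^ 2‖) :
    HasSum (fun p : ℤ × ℤ => (u ^ (2 * p.1 + 1) * v ^ (-(2 * p.2 + 1))) • K p.1 p.2)
      ((u * v / (u ^ 2 - v ^ 2)) • (J (u ^ 2) * (J (v ^ 2))⁻¹)) := by
  classical
  rw [WithPiTopology.hasSum_iff_hasSum_coeff]
  intro d
  have hsum := hasSum_sum (s := antidiagonal d) fun e _ =>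
    hasSum_vacuumPairing hu hv h (coeff e.1 laurentJ) (coeff e.2 laurentJInv)
  refine hasSum_of_eq hsum (fun p => ?_) ?_
  · rw [coeff_smul, coeff_K, mul_sum]
  · rw [coeff_smul, coeff_mul, ← map_laurentJ _ hu, ← map_laurentJInv _ hv, mul_sum]
    rfl

end SchurMeasure

end

noncomputable section

namespace SchurMeasure

open MvPowerSeries
open _root_.Finset hiding mem_antidiagonal antidiagonal
open _root_.Finset.HasAntidiagonal (mem_antidiagonal antidiagonal)

/-! ### The formal exponential of a logarithm -/

section Logarithm

variable {σ : Type*}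

/-- The Euler operator `∑_s s ∂/∂s`, which multiplies a monomial by its degree. -/
def euler : Derivation ℂ (MvPowerSeries σ ℂ) (MvPowerSeries σ ℂ) :=
  Derivation.mk'
    { toFun := fun f => fun d => (d.degree : ℂ) * coeff d f
      map_add' := fun f g => by
        ext1 d
        change (d.degree : ℂ) * coeff d (f + g) = d.degree * coeff d f + d.degree * coeff d g
        rw [map_add, mul_add]
      map_smul' := fun c f => by
        ext1 d
        change (d.degree : ℂ) * coeff d (c • f) = c * (d.degree * coeff d f)
        rw [coeff_smul, mul_left_comm] } <| fun f g => by
    classical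
    ext1 d
    rw [map_add, smul_eq_mul, smul_eq_mul, mul_comm g, coeff_mul, coeff_mul]
    change (d.degree : ℂ) * coeff d (f * g) = _
    rw [coeff_mul, mul_sum, ← sum_add_distrib]
    refine sum_congr rfl fun e he => ?_
    change _ = coeff e.1 f * (e.2.degree * coeff e.2 g) + e.1.degree * coeff e.1 f * coeff e.2 g
    rw [← mem_antidiagonal.1 he, map_add, Nat.cast_add]
    ring

theorem coeff_euler (f : MvPowerSeries σ ℂ) (d : σ →₀ ℕ) :
    coeff d (euler f) = d.degree * coeff d f := rfl

theorem continuous_euler :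
    Continuous (euler : MvPowerSeries σ ℂ → MvPowerSeries σ ℂ) :=
  continuous_pi fun d => continuous_const.mul (WithPiTopology.continuous_coeff ℂ d)

theorem euler_formalExp {X : MvPowerSeries σ ℂ} (hX : constantCoeff X = 0) :
    euler (formalExp X) = formalExp X * euler X := by
  have h1 := (hasSum_formalExp hX).mul_right (euler X)
  have h2 := (hasSum_formalExp hX).map (euler (σ := σ)) continuous_euler
  refine h2.unique ?_
  have h3 := (hasSum_nat_add_iff (f := euler ∘ fun m : ℕ => ((m.factorial : ℂ)⁻¹) • X ^ m)
    (g := formalExp X * euler X) 1).1 (hasSum_of_eq h1 (fun m => ?_) rfl)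
  · simpa using h3
  · rw [Function.comp_apply, Derivation.map_smul, Derivation.leibniz_pow, Nat.add_sub_cancel,
      Nat.factorial_succ, ← Nat.cast_smul_eq_nsmul ℂ, smul_smul, smul_eq_mul, smul_mul_assoc]
    congr 1
    have : (m.factorial : ℂ) ≠ 0 := by exact_mod_cast m.factorial_ne_zero
    have : (m : ℂ) + 1 ≠ 0 := by exact_mod_cast m.succ_ne_zero
    push_cast
    field_simp

/-- The logarithm series `-log (1 - P) = ∑_{k ≥ 1} P ^ k / k`. -/
def negLog (P : MvPowerSeries σ ℂ) : MvPowerSeries σ ℂ :=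
  ∑' k : ℕ+, ((k : ℕ) : ℂ)⁻¹ • P ^ (k : ℕ)

theorem hasSum_negLog {P : MvPowerSeries σ ℂ} (hP : constantCoeff P = 0) :
    HasSum (fun k : ℕ+ => ((k : ℕ) : ℂ)⁻¹ • P ^ (k : ℕ)) (negLog P) := by
  refine Summable.hasSum ?_
  rw [WithPiTopology.summable_iff_summable_coeff]
  intro d
  refine summable_of_hasFiniteSupport (((Set.finite_Iic d.degree).preimage
    PNat.coe_injective.injOn).subset ?_)
  intro k hk
  by_contra h
  rw [Set.mem_preimage, Set.mem_Iic, not_le] at h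
  refine hk ?_
  change coeff d (((k : ℕ) : ℂ)⁻¹ • P ^ (k : ℕ)) = 0
  rw [coeff_smul, coeff_pow_eq_zero P hP d _ h, mul_zero]

theorem constantCoeff_negLog {P : MvPowerSeries σ ℂ} (hP : constantCoeff P = 0) :
    constantCoeff (negLog P) = 0 := by
  refine ((hasSum_negLog hP).map (constantCoeff (σ := σ) (R := ℂ))
    (WithPiTopology.continuous_constantCoeff ℂ)).unique (hasSum_of_eq hasSum_zero (fun k => ?_) rfl)
  rw [Function.comp_apply, constantCoeff_smul, map_pow, hP, zero_pow k.ne_zero, smul_zero]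

/-- The logarithmic derivative of `(1 - P)⁻¹`, by termwise differentiation and the geometric
series. -/
theorem one_sub_mul_euler_negLog {P : MvPowerSeries σ ℂ} (hP : constantCoeff P = 0) :
    (1 - P) * euler (negLog P) = euler P := by
  have h1 := (hasSum_negLog hP).map (euler (σ := σ)) continuous_euler
  have h2 : HasSum (fun n : ℕ => P ^ n * euler P) (euler (negLog P)) := by
    rw [← Equiv.pnatEquivNat.hasSum_iff]
    refine hasSum_of_eq h1 (fun k => ?_) rfl
    have hk : ((k : ℕ) : ℂ) ≠ 0 := by exact_mod_cast k.ne_zero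
    rw [Function.comp_apply, Function.comp_apply, Derivation.map_smul, Derivation.leibniz_pow,
      ← Nat.cast_smul_eq_nsmul ℂ, smul_smul, inv_mul_cancel₀ hk, one_smul, smul_eq_mul]
    rfl
  have h3 := (WithPiTopology.summable_pow_of_constantCoeff_eq_zero hP).hasSum.mul_right (euler P)
  rw [h2.unique h3, ← mul_assoc,
    WithPiTopology.one_sub_mul_tsum_pow_of_constantCoeff_eq_zero hP, one_mul]

/-- Both sides of `(1 - P) * exp (-log (1 - P)) = 1` have constant term `1`, and the Euler operator,
which kills only constants, takes both to `0`. -/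
theorem one_sub_mul_formalExp_negLog {P : MvPowerSeries σ ℂ} (hP : constantCoeff P = 0) :
    (1 - P) * formalExp (negLog P) = 1 := by
  have h : euler ((1 - P) * formalExp (negLog P)) = 0 := by
    rw [Derivation.leibniz, euler_formalExp (constantCoeff_negLog hP), smul_eq_mul, smul_eq_mul,
      mul_left_comm, one_sub_mul_euler_negLog hP, map_sub, Derivation.map_one_eq_zero]
    ring
  classical
  ext1 d
  rw [coeff_one]
  split_ifs with hd
  · rw [hd, coeff_zero_eq_constantCoeff_apply, map_mul, constantCoeff_formalExp, map_sub, hP,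
      map_one]
    ring
  · have h' := congrArg (coeff d) h
    rw [coeff_euler, map_zero] at h'
    refine (mul_eq_zero.1 h').resolve_left ?_
    rwa [Nat.cast_eq_zero, Finsupp.degree_eq_zero_iff]

theorem formalExp_neg_negLog {P : MvPowerSeries σ ℂ} (hP : constantCoeff P = 0) :
    formalExp (-negLog P) = 1 - P := by
  have h1 := one_sub_mul_formalExp_negLog hP
  have h2 := formalExp_mul_formalExp_neg (constantCoeff_negLog hP)
  calc formalExp (-negLog P) = ((1 - P) * formalExp (negLog P)) * formalExp (-negLog P) := by
        rw [h1, one_mul]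
    _ = 1 - P := by rw [mul_assoc, h2, mul_one]

theorem formalExp_negLog {P : MvPowerSeries σ ℂ} (hP : constantCoeff P = 0) :
    formalExp (negLog P) = (1 - P)⁻¹ := by
  rw [MvPowerSeries.eq_inv_iff_mul_eq_one (by simp [hP]), mul_comm,
    one_sub_mul_formalExp_negLog hP]

theorem continuous_formalExp :
    Continuous (formalExp : MvPowerSeries σ ℂ → MvPowerSeries σ ℂ) :=
  continuous_pi fun d => continuous_finsetSum _ fun m _ =>
    ((WithPiTopology.continuous_coeff ℂ d).comp (continuous_pow m)).const_smul
      ((m.factorial : ℂ)⁻¹)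

/-- The exponential is continuous and takes finite sums to products, hence it takes infinite sums
to infinite products. -/
theorem hasProd_formalExp {ι : Type*} {X : ι → MvPowerSeries σ ℂ} {L : MvPowerSeries σ ℂ}
    (hX : ∀ i, constantCoeff (X i) = 0) (h : HasSum X L) :
    HasProd (fun i => formalExp (X i)) (formalExp L) := by
  have := (continuous_formalExp.tendsto L).comp h
  refine this.congr fun s => ?_
  rw [Function.comp_apply, formalExp_sum s hX]

end Logarithm

/-! ### Substitution of power sums -/

section Subst

variable {σ τ : Type*}

/-- Every coefficient of a substituted series depends on finitely many coefficients only, whence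
continuity also for the usual topology of `ℂ`. -/
theorem continuous_subst {a : σ → MvPowerSeries τ ℂ} (ha : HasSubst a) :
    Continuous (subst a : MvPowerSeries σ ℂ → MvPowerSeries τ ℂ) := by
  refine continuous_pi fun e => ?_
  -- The relevant exponents, found by substitution in the series with all coefficients `1`.
  have hfin := coeff_subst_finite ha (fun _ => 1 : MvPowerSeries σ ℂ) e
  have h : (fun f : MvPowerSeries σ ℂ => (subst a f : MvPowerSeries τ ℂ) e) = fun f =>
      ∑ d ∈ hfin.toFinset, coeff d f • coeff e (d.prod fun s n => a s ^ n) := by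
    ext1 f
    refine (coeff_subst ha f e).trans (finsum_eq_sum_of_support_subset _ fun d hd => ?_)
    refine hfin.mem_toFinset.2 fun h0 => ?_
    have h0' : (1 : ℂ) • coeff e (d.prod fun s n => a s ^ n) = 0 := h0
    rw [one_smul] at h0'
    exact hd (by simp only [h0', smul_zero])
  rw [h]
  exact continuous_finsetSum _ fun d _ => (WithPiTopology.continuous_coeff ℂ d).smul
    continuous_const

theorem subst_formalExp {a : σ → MvPowerSeries τ ℂ} (ha : HasSubst a)
    (ha0 : ∀ s, constantCoeff (a s) = 0) {X : MvPowerSeries σ ℂ} (hX : constantCoeff X = 0) :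
    subst a (formalExp X) = formalExp (subst a X) := by
  have h1 := (hasSum_formalExp hX).map (substAlgHom ha : MvPowerSeries σ ℂ →ₐ[ℂ] _)
    (by rw [coe_substAlgHom]; exact continuous_subst ha)
  have h2 := hasSum_formalExp (constantCoeff_subst_eq_zero ha ha0 hX)
  rw [← substAlgHom_apply ha]
  refine h1.unique (hasSum_of_eq h2 (fun m => ?_) rfl)
  rw [Function.comp_apply, map_smul, map_pow, substAlgHom_apply]

theorem hasSum_linearForm (a : σ → ℂ) :
    HasSum (fun s => a s • (X s : MvPowerSeries σ ℂ)) (linearForm a) := by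
  classical
  rw [WithPiTopology.hasSum_iff_hasSum_coeff]
  intro d
  have h : coeff d (linearForm a) = ∑ s ∈ d.support, coeff d (a s • (X s : MvPowerSeries σ ℂ)) := by
    rw [coeff_linearForm]
    refine sum_congr rfl fun s _ => ?_
    rw [coeff_smul, coeff_X]
    split_ifs <;> simp
  rw [h]
  refine hasSum_sum_of_ne_finset_zero fun s hs => ?_
  rw [coeff_smul, coeff_X, if_neg, mul_zero]
  rintro rfl
  exact hs (by simp)

theorem summable_monomial {ι : Type*} {e : ι → σ →₀ ℕ} (he : Function.Injective e) (c : ι → ℂ) :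
    Summable fun i => monomial (e i) (c i) := by
  classical
  rw [WithPiTopology.summable_iff_summable_coeff]
  intro d
  refine summable_of_hasFiniteSupport (((Set.finite_singleton d).preimage he.injOn).subset ?_)
  intro i hi
  by_contra h
  refine hi ?_
  change coeff d (monomial (e i) (c i)) = 0
  rw [coeff_monomial, if_neg (Ne.symm h)]

end Subst

/-- The index `k` of a parameter `t_k` or `t'_k`. -/
def paramIndex : Param → ℕ := Sum.elim (fun k => (k : ℕ)) fun k => (k : ℕ)

/-- The `i`-th of the variables whose power sum is substituted for a parameter: `x_i` for `t_k` and
`y_i` for `t'_k`. -/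
def paramVar (s : Param) (i : ℕ) : Var := Sum.map (fun _ => i) (fun _ => i) s

theorem paramIndex_ne_zero (s : Param) : paramIndex s ≠ 0 := by
  rcases s with k | k <;> exact k.ne_zero

/-- The monomials `x_i ^ k`, `y_i ^ k` are distinct, so that all sums over them converge
coefficient by coefficient. -/
theorem injective_single_paramVar : Function.Injective fun p : Param × ℕ =>
    Finsupp.single (paramVar p.1 p.2) (paramIndex p.1) := by
  rintro ⟨s, i⟩ ⟨s', i'⟩ h
  simp only [Finsupp.single_eq_single_iff, paramIndex_ne_zero, false_and, or_false] at h
  rcases s with k | k <;> rcases s' with k' | k' <;> simp_all [paramVar, paramIndex]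

theorem hasSum_miwa (s : Param) :
    HasSum (fun i => (paramIndex s : ℂ)⁻¹ • (X (paramVar s i) : MvPowerSeries Var ℂ) ^ paramIndex s)
      (miwa s) := by
  have h1 : Summable fun i => (X (paramVar s i) : MvPowerSeries Var ℂ) ^ paramIndex s := by
    simp only [X_pow_eq]
    exact summable_monomial
      (injective_single_paramVar.comp (Prod.mk_right_injective s)) fun _ => 1
  have h2 : miwa s = (paramIndex s : ℂ)⁻¹ •
      ∑' i, (X (paramVar s i) : MvPowerSeries Var ℂ) ^ paramIndex s := by
    rcases s with k | k <;> rfl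
  rw [h2]
  exact h1.hasSum.const_smul _

theorem coeff_miwa_eq_zero {s : Param} {d : Var →₀ ℕ} (h : d.degree ≠ paramIndex s) :
    coeff d (miwa s) = 0 := by
  classical
  refine (WithPiTopology.hasSum_iff_hasSum_coeff.1 (hasSum_miwa s) d).unique
    (hasSum_of_eq hasSum_zero (fun i => ?_) rfl)
  rw [coeff_smul, coeff_X_pow, if_neg, mul_zero]
  rintro rfl
  exact h (by simp)

theorem constantCoeff_miwa (s : Param) : constantCoeff (miwa s) = 0 := by
  rw [← coeff_zero_eq_constantCoeff_apply, coeff_miwa_eq_zero]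
  simpa using (paramIndex_ne_zero s).symm

theorem hasSubst_miwa : HasSubst miwa where
  const_coeff s := by rw [constantCoeff_miwa]; exact IsNilpotent.zero
  coeff_zero d := by
    have hfin : {k : ℕ+ | (k : ℕ) = d.degree}.Finite :=
      Set.Subsingleton.finite fun k hk l hl => PNat.coe_injective (hk.trans hl.symm)
    refine ((hfin.image Sum.inl).union (hfin.image Sum.inr)).subset fun s hs => ?_
    have h : d.degree = paramIndex s := by
      by_contra h
      exact hs (coeff_miwa_eq_zero h)
    rcases s with k | k
    · exact Or.inl ⟨k, h.symm, rfl⟩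
    · exact Or.inr ⟨k, h.symm, rfl⟩

theorem inVars_mul (f g : MvPowerSeries Param ℂ) : inVars (f * g) = inVars f * inVars g :=
  subst_mul hasSubst_miwa f g

theorem inVars_J (z : ℂ) :
    inVars (J z) = formalExp (inVars (linearForm
      (Sum.elim (fun k : ℕ+ => z ^ (k : ℕ)) fun k : ℕ+ => -(z⁻¹) ^ (k : ℕ)))) :=
  subst_formalExp hasSubst_miwa constantCoeff_miwa (constantCoeff_linearForm _)

theorem inVars_inv_J (z : ℂ) : inVars (J z)⁻¹ = (inVars (J z))⁻¹ := by
  have h1 : constantCoeff (J z) ≠ 0 := by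
    rw [J, constantCoeff_formalExp]
    exact one_ne_zero
  have h2 : constantCoeff (inVars (J z)) ≠ 0 := by
    rw [inVars_J, constantCoeff_formalExp]
    exact one_ne_zero
  rw [MvPowerSeries.eq_inv_iff_mul_eq_one h2, ← inVars_mul, MvPowerSeries.inv_mul_cancel _ h1,
    inVars, ← substAlgHom_apply hasSubst_miwa, map_one]

/-- Under the substitution of power sums the exponent of `J` becomes
`∑_i (-log (1 - x_i z) + log (1 - y_i / z))`. -/
theorem hasProd_inVars_J (z : ℂ) :
    HasProd (fun i : ℕ => ((1 - z⁻¹ • X (Sum.inr i)) * (1 - z • X (Sum.inl i))⁻¹ :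
      MvPowerSeries Var ℂ)) (inVars (J z)) := by
  set a : Param → ℂ := Sum.elim (fun k : ℕ+ => z ^ (k : ℕ)) fun k : ℕ+ => -(z⁻¹) ^ (k : ℕ) with ha
  have hx : ∀ i, constantCoeff (z • X (Sum.inl i) : MvPowerSeries Var ℂ) = 0 := by simp
  have hy : ∀ i, constantCoeff (z⁻¹ • X (Sum.inr i) : MvPowerSeries Var ℂ) = 0 := by simp
  have hfac : ∀ i, ((1 - z⁻¹ • X (Sum.inr i)) * (1 - z • X (Sum.inl i))⁻¹ : MvPowerSeries Var ℂ) =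
      formalExp (negLog (z • X (Sum.inl i)) + -negLog (z⁻¹ • X (Sum.inr i))) := fun i => by
    rw [formalExp_add (constantCoeff_negLog (hx i))
      (by rw [map_neg, constantCoeff_negLog (hy i), neg_zero]), formalExp_negLog (hx i),
      formalExp_neg_negLog (hy i), mul_comm]
  rw [inVars_J, ← ha]
  simp only [hfac]
  refine hasProd_formalExp (fun i => by
    rw [map_add, map_neg, constantCoeff_negLog (hx i), constantCoeff_negLog (hy i), neg_zero,
      add_zero]) ?_
  -- Both sums over the parameters and over the variables are fiberwise sums of one double series.
  set g : Param × ℕ → MvPowerSeries Var ℂ := fun p =>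
    a p.1 • (paramIndex p.1 : ℂ)⁻¹ • X (paramVar p.1 p.2) ^ paramIndex p.1 with hg
  have hsum : Summable g := by
    refine (summable_monomial injective_single_paramVar
      fun p => a p.1 * (paramIndex p.1 : ℂ)⁻¹).congr fun p => ?_
    rw [hg]
    simp only [X_pow_eq, smul_smul]
    rw [← map_smul, smul_eq_mul, mul_one]
  have h1 : HasSum (fun s => a s • miwa s) (∑' p, g p) :=
    hsum.hasSum.prod_fiberwise fun s => (hasSum_miwa s).const_smul (a s)
  have h2 : HasSum (fun s => a s • miwa s) (inVars (linearForm a)) := by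
    have h := (hasSum_linearForm a).map
      (substAlgHom hasSubst_miwa : MvPowerSeries Param ℂ →ₐ[ℂ] MvPowerSeries Var ℂ)
      (by rw [coe_substAlgHom]; exact continuous_subst hasSubst_miwa)
    rw [substAlgHom_apply] at h
    refine hasSum_of_eq h (fun s => ?_) rfl
    rw [Function.comp_apply, map_smul, substAlgHom_X]
  rw [h2.unique h1]
  refine ((Equiv.prodComm ℕ Param).hasSum_iff.2 hsum.hasSum).prod_fiberwise fun i => ?_
  refine HasSum.sum (hasSum_of_eq (hasSum_negLog (hx i)) (fun k => ?_) rfl)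
    (hasSum_of_eq (hasSum_negLog (hy i)).neg (fun k => ?_) rfl)
  · simp only [Function.comp_apply, Equiv.prodComm_apply, Prod.swap_prod_mk, hg, ha, Sum.elim_inl,
      paramIndex, paramVar, Sum.map_inl]
    rw [smul_pow, smul_comm]
  · simp only [Function.comp_apply, Equiv.prodComm_apply, Prod.swap_prod_mk, hg, ha, Sum.elim_inr,
      paramIndex, paramVar, Sum.map_inr]
    rw [smul_pow, smul_comm, neg_smul, smul_neg]

end SchurMeasure

end

theorem theorem2 (z w u v : ℂ) (hu : u ^ 2 = z) (hv : v ^ 2 = w) (hw : w ≠ 0) (hwz : ‖w‖ < ‖z‖) :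
    -- the generating function in the parameters `t`, `t'`; here `z ^ (i + 1/2) = u ^ (2 * i + 1)`,
    -- `w ^ (-(j + 1/2)) = v ^ (-(2 * j + 1))` and `√(z w) = u v`
    HasSum
      (fun p : ℤ × ℤ => (u ^ (2 * p.1 + 1) * v ^ (-(2 * p.2 + 1))) • SchurMeasure.K p.1 p.2)
      ((u * v / (z - w)) • (SchurMeasure.J z * (SchurMeasure.J w)⁻¹)) ∧
    -- the same identity in the variables `x`, `y`
    HasSum
      (fun p : ℤ × ℤ => (u ^ (2 * p.1 + 1) * v ^ (-(2 * p.2 + 1))) •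
        SchurMeasure.inVars (SchurMeasure.K p.1 p.2))
      ((u * v / (z - w)) • (SchurMeasure.inVars (SchurMeasure.J z) *
        (SchurMeasure.inVars (SchurMeasure.J w))⁻¹)) ∧
    -- the product formula `J(ζ) = ∏ᵢ (1 - yᵢ / ζ) / (1 - xᵢ ζ)`
    ∀ ζ : ℂ, ζ ≠ 0 →
      HasProd
        (fun i : ℕ =>
          ((1 - ζ⁻¹ • MvPowerSeries.X (Sum.inr i)) * (1 - ζ • MvPowerSeries.X (Sum.inl i))⁻¹ :
            MvPowerSeries SchurMeasure.Var ℂ))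
        (SchurMeasure.inVars (SchurMeasure.J ζ)) := by
  subst hu hv
  have hv0 : v ^ 2 ≠ 0 := hw
  have hu0 : u ^ 2 ≠ 0 := norm_pos_iff.1 ((norm_nonneg _).trans_lt hwz)
  refine ⟨SchurMeasure.hasSum_K hu0 hv0 hwz, ?_, fun ζ _ => SchurMeasure.hasProd_inVars_J ζ⟩
  have h := (SchurMeasure.hasSum_K hu0 hv0 hwz).map
    (MvPowerSeries.substAlgHom SchurMeasure.hasSubst_miwa :
      MvPowerSeries SchurMeasure.Param ℂ →ₐ[ℂ] MvPowerSeries SchurMeasure.Var ℂ)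
    (by rw [MvPowerSeries.coe_substAlgHom]
        exact SchurMeasure.continuous_subst SchurMeasure.hasSubst_miwa)
  refine SchurMeasure.hasSum_of_eq h (fun p => ?_) ?_
  · rw [Function.comp_apply, map_smul, MvPowerSeries.substAlgHom_apply, SchurMeasure.inVars]
  · rw [map_smul, MvPowerSeries.substAlgHom_apply, ← SchurMeasure.inVars, SchurMeasure.inVars_mul,
      SchurMeasure.inVars_inv_J]
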